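/- Let $\epsilon,\gamma\in(0,1)$ and let $\ell$ be a positive integer with $$\ell \;\ge\; \max\left\{\frac{2e^2}{\gamma}\log\frac1\epsilon,\ \frac{2e^2}{\gamma}\log(4e^2)\right\}.$$ Let $P_\ell$ be a path on the vertex set $\{1,\dots,\ell\}$, and let $T_n$ be the uniform attachment tree with seed $P_\ell$: $T_\ell=P_\ell$ and, for $\ell<i\le n$, $T_i$ is obtained from $T_{i-1}$ by joining the new vertex $i$ to a vertex of $T_{i-1}$ chosen uniformly at random, independently of all previous choices. Then there is an integer $k$ with $(1-\gamma)\ell\le k\le \ell$ such that, for all sufficiently large $n\geq \ell$, there exists a seed-finding algorithm which, given the tree $T_n$ with its vertex labels hidden (that is, given $T_n$ with its vertices renamed in an arbitrary way), outputs a set $H_n$ of exactly $k$ vertices (so $|H_n|\ge(1-\gamma)\ell$) with $$\mathbb P\{H_n\subset P_\ell\}\ \ge\ 1-\epsilon,$$ where $P_\ell$ is identified with its vertex set. Here the event means that the output lies in the seed whatever the renaming of the vertices is. -/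

import Mathlib

/-- The graph on `Fin (m + 1)` obtained from a graph `G` on `Fin m` by adding the new vertex
`Fin.last m` and joining it by a single edge to the vertex `p` of `G`. -/
def attachVertex {m : ℕ} (G : SimpleGraph (Fin m)) (p : Fin m) : SimpleGraph (Fin (m + 1)) :=
  G.map Fin.castSucc ⊔ SimpleGraph.edge p.castSucc (Fin.last m)

/-- The law of the uniform attachment tree with seed `S` on `ℓ` vertices, after `d` further
vertices have arrived (so on `n = ℓ + d` vertices, the seed occupying the first `ℓ` of them).
Each new vertex is joined to an existing vertex that is chosen uniformly at random,
independently of all previous choices. -/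
noncomputable def uniformAttachment {ℓ : ℕ} [NeZero ℓ] (S : SimpleGraph (Fin ℓ)) :
    (d : ℕ) → PMF (SimpleGraph (Fin (ℓ + d)))
  | 0 => PMF.pure S
  | d + 1 =>
    (uniformAttachment S d).bind fun T =>
      haveI : Nonempty (Fin (ℓ + d)) := ⟨Fin.castAdd d 0⟩
      (PMF.uniformOfFintype (Fin (ℓ + d))).bind fun p => PMF.pure (attachVertex T p)

/-- The set of the seed vertices (the first `ℓ` vertices) inside the vertex set of the grown
tree. -/
def seedVertices (ℓ d : ℕ) : Finset (Fin (ℓ + d)) :=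
  Finset.univ.map (Fin.castAddEmb d)

/-- A procedure which, given a graph on `n` vertices with arbitrary vertex names, outputs a set
of exactly `k` of its vertices. -/
structure VertexSelector (n k : ℕ) where
  /-- The output on the observed graph. -/
  select : SimpleGraph (Fin n) → Finset (Fin n)
  card_select : ∀ G, (select G).card = k

/-- The procedure `A`, run on the tree `T` with its labels hidden, outputs only vertices of `V`:
whatever names `π` the vertices of `T` are given before `A` sees the tree, the vertices that
`A` outputs are names of elements of `V`. -/
def VertexSelector.FindsOnly {n k : ℕ} (A : VertexSelector n k) (V : Finset (Fin n))
    (T : SimpleGraph (Fin n)) : Prop :=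
  ∀ π : Equiv.Perm (Fin n), A.select (T.map π) ⊆ V.map π.toEmbedding

/-! Let `a + r` be the floor of `γ * ℓ / 2`, with `a` and `r` differing by at most one, and call a
set of vertices heavy if it has at least `K = 3 * n / ℓ + 1` elements (natural-number division). The
algorithm looks for any path on `ℓ - 2 * a` vertices whose two end edges each cut off a heavy set,
and returns it without `r` vertices at either end. This property does not depend on names, so it
suffices that such a path exists and that every such path yields only seed vertices.

Existence: drop `a` vertices at each end of the seed. Each end edge of what remains cuts off `a + 1`
seed vertices with the trees hanging on them, which is a Pólya urn. A negative factorial moment of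
its size is a martingale, and it makes a block with fewer than `K` vertices unlikely.

Soundness: if an end of a candidate path lies off the seed and the path climbs from there, that end
has at least `K` descendants. A third factorial moment of subtree sizes, weighted by `2` to the
distance from the seed, shows that with high probability every such vertex is within `r` of the
seed, or within a larger radius if it hangs far from both ends of the seed. A candidate end deeper
than `r` would make the path too short (`path_inner_lt`), so only the `r` outer vertices at either
end can leave the seed.

The three martingales, scaled so that each is at least `1` when its bad event occurs, are added. The
initial value of the sum bounds the failure probability (`le_tsum_uniformAttachment`) and is at most
`(6 / 7) ^ (a + r + 1) ≤ ε`. -/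

/-- The distance of the vertex `v` from the seed `{0, …, ℓ - 1}` in the tree in which each later
vertex `v` is joined to its parent `f v`. -/
def seedDist (ℓ : ℕ) (f : ℕ → ℕ) (v : ℕ) : ℕ :=
  if ℓ ≤ v ∧ f v < v then seedDist ℓ f (f v) + 1 else 0
termination_by v
decreasing_by omega

/-- The value of `pos` at the seed vertex closest to `v`. -/
def seedPos (ℓ : ℕ) (pos f : ℕ → ℕ) (v : ℕ) : ℕ :=
  if ℓ ≤ v ∧ f v < v then seedPos ℓ pos f (f v) else pos v
termination_by v
decreasing_by omega

/-- The vertices outside the seed on the way from `v` to the seed, including `v`. -/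
def branch (ℓ : ℕ) (f : ℕ → ℕ) (v : ℕ) : Finset ℕ :=
  if ℓ ≤ v ∧ f v < v then insert v (branch ℓ f (f v)) else ∅
termination_by v
decreasing_by omega

/-- The number of vertices below `n` in the subtree of descendants of `v`. -/
def subtreeSize (ℓ : ℕ) (f : ℕ → ℕ) (n v : ℕ) : ℕ :=
  ((Finset.range n).filter fun w => v ∈ branch ℓ f w).card

/-- Every vertex outside the seed has an earlier vertex as its parent. -/
def IsParentMap (ℓ : ℕ) (f : ℕ → ℕ) : Prop :=
  ∀ v, ℓ ≤ v → f v < v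

/-- Adjacency in the tree grown by the parent map `f` from the path in which `pos` lists
the positions of the seed vertices. -/
def GrownAdj (ℓ : ℕ) (pos f : ℕ → ℕ) (u v : ℕ) : Prop :=
  (u < ℓ ∧ v < ℓ ∧ (pos u + 1 = pos v ∨ pos v + 1 = pos u)) ∨
    (ℓ ≤ u ∧ f u = v) ∨ (ℓ ≤ v ∧ f v = u)

/-! ### Combinatorics of the parent map; edge cuts and descendants. -/

section Tree

variable {ℓ : ℕ} {pos f : ℕ → ℕ}

theorem GrownAdj.symm {u v : ℕ} (h : GrownAdj ℓ pos f u v) : GrownAdj ℓ pos f v u := by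
  unfold GrownAdj at *
  tauto

theorem seedDist_of_lt {v : ℕ} (h : v < ℓ) : seedDist ℓ f v = 0 := by
  rw [seedDist, if_neg (by omega)]

theorem seedPos_of_lt {v : ℕ} (h : v < ℓ) : seedPos ℓ pos f v = pos v := by
  rw [seedPos, if_neg (by omega)]

theorem branch_of_lt {v : ℕ} (h : v < ℓ) : branch ℓ f v = ∅ := by
  rw [branch, if_neg (by omega)]

theorem seedDist_of_le (hf : IsParentMap ℓ f) {v : ℕ} (h : ℓ ≤ v) :
    seedDist ℓ f v = seedDist ℓ f (f v) + 1 := by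
  rw [seedDist, if_pos ⟨h, hf v h⟩]

theorem seedPos_of_le (hf : IsParentMap ℓ f) {v : ℕ} (h : ℓ ≤ v) :
    seedPos ℓ pos f v = seedPos ℓ pos f (f v) := by
  rw [seedPos, if_pos ⟨h, hf v h⟩]

theorem branch_of_le (hf : IsParentMap ℓ f) {v : ℕ} (h : ℓ ≤ v) :
    branch ℓ f v = insert v (branch ℓ f (f v)) := by
  rw [branch, if_pos ⟨h, hf v h⟩]

theorem mem_branch_le (f : ℕ → ℕ) (v : ℕ) : ∀ u ∈ branch ℓ f v, ℓ ≤ u ∧ u ≤ v := by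
  induction v using Nat.strong_induction_on with
  | _ v ih =>
    intro u hu
    rw [branch] at hu
    split_ifs at hu with h
    · rcases Finset.mem_insert.1 hu with rfl | hu
      · exact ⟨h.1, le_rfl⟩
      · have := ih _ h.2 u hu
        omega
    · simp at hu

theorem seedPos_lt (hf : IsParentMap ℓ f) (hpos : ∀ i < ℓ, pos i < ℓ) (v : ℕ) :
    seedPos ℓ pos f v < ℓ := by
  induction v using Nat.strong_induction_on with
  | _ v ih =>
    by_cases h : ℓ ≤ v
    · rw [seedPos_of_le hf h]
      exact ih _ (hf v h)
    · rw [seedPos_of_lt (by omega)]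
      exact hpos v (by omega)

/-- A set of vertices of the grown tree that contains `x`, but not its parent, and that no other
edge leaves, consists of descendants of `x`. -/
theorem mem_branch_of_mem_cut (hf : IsParentMap ℓ f) {n : ℕ}
    (hinj : ∀ i < ℓ, ∀ j < ℓ, pos i = pos j → i = j)
    (hsurj : ∀ i < ℓ, ∃ j < ℓ, pos j = i) (hpos : ∀ i < ℓ, pos i < ℓ) (hn : ℓ ≤ n)
    {W : ℕ → Prop} {x : ℕ} (hx : ℓ ≤ x) (hxn : x < n) (hW : ¬ W (f x))
    (hcut : ∀ u < n, ∀ v < n, W u → ¬ W v → GrownAdj ℓ pos f u v → u = x ∧ v = f x)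
    {w : ℕ} (hwn : w < n) (hw : W w) : x ∈ branch ℓ f w := by
  -- The only edge leaving `W` ends at `x`, so membership in `W` is constant along edges avoiding
  -- `x`.
  have hstep : ∀ u < n, ∀ v < n, u ≠ x → v ≠ x → GrownAdj ℓ pos f u v → (W u ↔ W v) := by
    intro u hu v hv hux hvx h
    constructor
    · intro h1
      by_contra h2
      exact hux (hcut u hu v hv h1 h2 h).1
    · intro h1
      by_contra h2
      exact hvx (hcut v hv u hu h1 h2 h.symm).1
  have hℓ : 0 < ℓ ∨ ℓ = 0 := by omega
  rcases hℓ with hℓ | hℓ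
  swap
  · exfalso
    -- With an empty seed the parent map would descend forever.
    have key : ∀ _ : ℕ, False := by
      intro v
      induction v using Nat.strong_induction_on with
      | _ v ih => exact ih _ (hf v (by omega))
    exact key 0
  obtain ⟨z, hz, hz0⟩ := hsurj 0 hℓ
  have hseed : ∀ i, ∀ v < ℓ, pos v = i → (W v ↔ W z) := by
    intro i
    induction i with
    | zero =>
      intro v hv h0
      rw [hinj v hv z hz (by omega)]
    | succ i ih =>
      intro v hv hi
      obtain ⟨u, hu, hui⟩ := hsurj i (by have := hpos v hv; omega)
      rw [← ih u hu hui]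
      exact hstep v (by omega) u (by omega) (by omega) (by omega) (Or.inl ⟨hv, hu, by omega⟩)
  -- Vertices not below `x` reach the seed without passing `x`, so `W` contains all of them or none;
  -- as `f x` is among them, none.
  have hall : ∀ v < n, x ∉ branch ℓ f v → (W v ↔ W z) := by
    intro v
    induction v using Nat.strong_induction_on with
    | _ v ih =>
      intro hvn hv
      by_cases h : ℓ ≤ v
      · rw [branch_of_le hf h, Finset.mem_insert, not_or] at hv
        have hlt := hf v h
        rw [← ih _ hlt (by omega) hv.2]
        have hne : f v ≠ x := by
          intro hfx
          apply hv.2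
          rw [hfx, branch_of_le hf hx]
          exact Finset.mem_insert_self _ _
        exact hstep v hvn (f v) (by omega) (Ne.symm hv.1) hne (Or.inr (Or.inl ⟨h, rfl⟩))
      · exact hseed _ v (by omega) rfl
  by_contra hcon
  have hlt := hf x hx
  apply hW
  rw [hall (f x) (by omega) (fun h => by have := mem_branch_le f _ x h; omega),
    ← hall w hwn hcon]
  exact hw

end Tree

/-! ### Geometry of paths in the grown tree. -/

section Path

variable {ℓ : ℕ} {pos f : ℕ → ℕ} {q : ℕ} {y : ℕ → ℕ}

/-- The step from `u` to `v` leads from a vertex outside the seed to its parent. -/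
def IsUp (ℓ : ℕ) (f : ℕ → ℕ) (u v : ℕ) : Prop := ℓ ≤ u ∧ f u = v

/-- A climbing step cannot follow a seed edge, which ends in the seed, nor a descending step, which
it would undo. So all earlier steps climb as well, and each lowers the distance by one. -/
theorem seedDist_zero_of_up (hf : IsParentMap ℓ f)
    (hy : ∀ s < q, ∀ t < q, y s = y t → s = t)
    (hadj : ∀ t, t + 1 < q → GrownAdj ℓ pos f (y t) (y (t + 1))) (t : ℕ) (ht : t + 1 < q)
    (hup : IsUp ℓ f (y t) (y (t + 1))) : seedDist ℓ f (y 0) = seedDist ℓ f (y t) + t := by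
  induction t with
  | zero => rfl
  | succ t ih =>
    have hprev : IsUp ℓ f (y t) (y (t + 1)) := by
      rcases hadj t (by omega) with h | h | h
      · have := hup.1
        omega
      · exact h
      · have := hy t (by omega) (t + 1 + 1) (by omega) (by rw [← h.2, hup.2])
        omega
    rw [ih (by omega) hprev, seedDist_of_le hf hprev.1, hprev.2]
    omega

theorem reverse_path (hy : ∀ s < q, ∀ t < q, y s = y t → s = t)
    (hadj : ∀ t, t + 1 < q → GrownAdj ℓ pos f (y t) (y (t + 1))) :
    (∀ s < q, ∀ t < q, y (q - 1 - s) = y (q - 1 - t) → s = t) ∧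
      ∀ t, t + 1 < q → GrownAdj ℓ pos f (y (q - 1 - t)) (y (q - 1 - (t + 1))) := by
  constructor
  · intro s hs t ht h
    have := hy _ (by omega) _ (by omega) h
    omega
  · intro t ht
    have h := hadj (q - 1 - (t + 1)) (by omega)
    rw [show q - 1 - (t + 1) + 1 = q - 1 - t by omega] at h
    exact h.symm

theorem seedDist_last_of_down (hf : IsParentMap ℓ f)
    (hy : ∀ s < q, ∀ t < q, y s = y t → s = t)
    (hadj : ∀ t, t + 1 < q → GrownAdj ℓ pos f (y t) (y (t + 1))) (t : ℕ) (ht : t + 1 < q)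
    (hdown : IsUp ℓ f (y (t + 1)) (y t)) :
    seedDist ℓ f (y (q - 1)) = seedDist ℓ f (y (t + 1)) + (q - 2 - t) := by
  obtain ⟨hy', hadj'⟩ := reverse_path hy hadj
  have h := seedDist_zero_of_up (y := fun t => y (q - 1 - t)) hf hy' hadj' (q - 2 - t) (by omega)
    (by
      simpa only [show q - 1 - (q - 2 - t) = t + 1 by omega,
        show q - 1 - (q - 2 - t + 1) = t by omega] using hdown)
  simpa only [show q - 1 - (q - 2 - t) = t + 1 by omega, Nat.sub_zero] using h

/-- A path leaves the seed only near its two ends. -/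
theorem lt_seedDist_of_notMem_seed (hf : IsParentMap ℓ f)
    (hy : ∀ s < q, ∀ t < q, y s = y t → s = t)
    (hadj : ∀ t, t + 1 < q → GrownAdj ℓ pos f (y t) (y (t + 1))) (t : ℕ) (ht : t < q)
    (hoff : ℓ ≤ y t) : t < seedDist ℓ f (y 0) ∨ q - 1 - t < seedDist ℓ f (y (q - 1)) := by
  rcases t with _ | t
  · left
    rw [seedDist_of_le hf hoff]
    omega
  · have hd := seedDist_of_le hf hoff
    rcases hadj t ht with h | h | h
    · omega
    · left
      have h1 := seedDist_zero_of_up hf hy hadj t ht h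
      have h2 := seedDist_of_le hf h.1
      rw [h.2] at h2
      omega
    · right
      have h1 := seedDist_last_of_down hf hy hadj t ht h
      omega

/-- The length of a path in terms of the distances of its end vertices from the seed and the
positions where they hang on the seed. -/
theorem path_length_le (hf : IsParentMap ℓ f)
    (hinj : ∀ i < ℓ, ∀ j < ℓ, pos i = pos j → i = j)
    (hy : ∀ s < q, ∀ t < q, y s = y t → s = t)
    (hadj : ∀ t, t + 1 < q → GrownAdj ℓ pos f (y t) (y (t + 1))) (t : ℕ) (ht : t < q) :
    t ≤ seedDist ℓ f (y 0) + seedDist ℓ f (y t) +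
      ((seedPos ℓ pos f (y 0) - seedPos ℓ pos f (y t)) +
        (seedPos ℓ pos f (y t) - seedPos ℓ pos f (y 0))) := by
  have hD0 : ∀ v < ℓ, seedDist ℓ f v = 0 := fun v hv => seedDist_of_lt hv
  have hD1 : ∀ u v, ℓ ≤ u → f u = v → seedDist ℓ f u = seedDist ℓ f v + 1 := by
    rintro u _ hu rfl
    exact seedDist_of_le hf hu
  have hP0 : ∀ v < ℓ, seedPos ℓ pos f v = pos v := fun v hv => seedPos_of_lt hv
  have hP1 : ∀ u v, ℓ ≤ u → f u = v → seedPos ℓ pos f u = seedPos ℓ pos f v := by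
    rintro u _ hu rfl
    exact seedPos_of_le hf hu
  generalize seedDist ℓ f = D at *
  generalize seedPos ℓ pos f = P at *
  -- A path climbs to the seed, runs along it in one direction, then descends; the four alternatives
  -- are still climbing, running up, running down and descending. The first three record the length
  -- exactly, which the induction needs.
  have key : ∀ t < q,
      (t + D (y t) = D (y 0) ∧ P (y t) = P (y 0)) ∨
      (1 ≤ t ∧ y t < ℓ ∧ y (t - 1) < ℓ ∧ P (y t) = P (y (t - 1)) + 1 ∧
        t + P (y 0) = D (y 0) + P (y t)) ∨
      (1 ≤ t ∧ y t < ℓ ∧ y (t - 1) < ℓ ∧ P (y (t - 1)) = P (y t) + 1 ∧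
        t + P (y t) = D (y 0) + P (y 0)) ∨
      (1 ≤ t ∧ ℓ ≤ y t ∧ f (y t) = y (t - 1) ∧
        t ≤ D (y 0) + D (y t) + ((P (y 0) - P (y t)) + (P (y t) - P (y 0)))) := by
    intro t
    induction t with
    | zero => intro _; left; simp
    | succ t ih =>
      intro ht
      have hprev := ih (by omega)
      simp only [Nat.add_sub_cancel]
      rcases hadj t ht with h | h | h
      · obtain ⟨h1, h2, h3⟩ := h
        have e1 := hP0 _ h1
        have e2 := hP0 _ h2
        have d1 := hD0 _ h1
        -- The path cannot reverse on the seed, as it would revisit a vertex.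
        have back : 1 ≤ t → y (t - 1) < ℓ → P (y (t - 1)) ≠ P (y (t + 1)) := by
          intro ht1 hlt heq
          have e3 := hP0 _ hlt
          have := hy _ (by omega) _ ht (hinj _ hlt _ h2 (by omega))
          omega
        rw [← e1, ← e2] at h3
        rcases hprev with ⟨p1, p2⟩ | ⟨p0, p1, p2, p3, p4⟩ | ⟨p0, p1, p2, p3, p4⟩ | ⟨p0, p1, p2, p3⟩
        · rcases h3 with h3 | h3
          · exact Or.inr (Or.inl ⟨by omega, h2, h1, by omega, by omega⟩)
          · exact Or.inr (Or.inr (Or.inl ⟨by omega, h2, h1, by omega, by omega⟩))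
        · have hne := back p0 p2
          exact Or.inr (Or.inl ⟨by omega, h2, h1, by omega, by omega⟩)
        · have hne := back p0 p2
          exact Or.inr (Or.inr (Or.inl ⟨by omega, h2, h1, by omega, by omega⟩))
        · omega
      · have d1 := hD1 _ _ h.1 h.2
        have e1 := hP1 _ _ h.1 h.2
        have h1 := h.1
        rcases hprev with ⟨p1, p2⟩ | ⟨p0, p1, -⟩ | ⟨p0, p1, -⟩ | ⟨p0, p1, p2, p3⟩
        · exact Or.inl ⟨by omega, by omega⟩
        · omega
        · omega
        · have := hy (t + 1) ht (t - 1) (by omega) (by rw [← h.2, p2])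
          omega
      · have d1 := hD1 _ _ h.1 h.2
        have e1 := hP1 _ _ h.1 h.2
        refine Or.inr (Or.inr (Or.inr ⟨by omega, h.1, h.2, ?_⟩))
        rw [e1, d1]
        rcases hprev with ⟨p1, p2⟩ | ⟨p0, p1, p2, p3, p4⟩ | ⟨p0, p1, p2, p3, p4⟩ | ⟨p0, p1, p2, p3⟩
        all_goals omega
  rcases key t ht with ⟨p1, p2⟩ | ⟨p0, p1, p2, p3, p4⟩ | ⟨p0, p1, p2, p3, p4⟩ | ⟨p0, p1, p2, p3⟩
  all_goals omega

/-- If every vertex with many descendants is close to the seed, in a sense that depends on where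
it hangs on the seed, then the inner vertices of a long path both of whose ends have many
descendants belong to the seed. -/
theorem path_inner_lt (hf : IsParentMap ℓ f)
    (hinj : ∀ i < ℓ, ∀ j < ℓ, pos i = pos j → i = j) (hpos : ∀ i < ℓ, pos i < ℓ)
    (hy : ∀ s < q, ∀ t < q, y s = y t → s = t)
    (hadj : ∀ t, t + 1 < q → GrownAdj ℓ pos f (y t) (y (t + 1))) {a r : ℕ}
    (hq : q + 2 * a = ℓ) (hqr : r + 1 < q)
    (h0 : IsUp ℓ f (y 0) (y 1) → seedDist ℓ f (y 0) ≤
      max r (min (seedPos ℓ pos f (y 0)) (ℓ - 1 - seedPos ℓ pos f (y 0)) - (2 * a + r + 1)))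
    (h1 : IsUp ℓ f (y (q - 1)) (y (q - 2)) → seedDist ℓ f (y (q - 1)) ≤
      max r (min (seedPos ℓ pos f (y (q - 1))) (ℓ - 1 - seedPos ℓ pos f (y (q - 1))) -
        (2 * a + r + 1)))
    {t : ℕ} (ht : r ≤ t) (htq : t + r < q) : y t < ℓ := by
  by_contra hoff
  have hoff' := lt_seedDist_of_notMem_seed hf hy hadj t (by omega) (by omega)
  have hlen := path_length_le hf hinj hy hadj (q - 1) (by omega)
  have hp0 := seedPos_lt hf hpos (y 0)
  have hp1 := seedPos_lt hf hpos (y (q - 1))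
  have e : q - 2 + 1 = q - 1 := by omega
  have last := hadj (q - 2) (by omega)
  rw [e] at last
  have b0 : seedDist ℓ f (y 0) = 0 ∨ IsUp ℓ f (y 0) (y 1) := by
    rcases hadj 0 (by omega) with h | h | h
    · exact Or.inl (seedDist_of_lt h.1)
    · exact Or.inr h
    · by_cases h0 : y 0 < ℓ
      · exact Or.inl (seedDist_of_lt h0)
      -- If the path starts off the seed by descending, it descends all the way, so its last vertex
      -- is at distance at least `q - 1`, more than `h1` allows.
      exfalso
      have hd := seedDist_last_of_down hf hy hadj 0 (by omega) h
      have hd0 := seedDist_of_le hf h.1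
      have hup : IsUp ℓ f (y (q - 1)) (y (q - 2)) := by
        rcases last with h' | h' | h'
        · rw [seedDist_of_lt h'.2.1] at hd
          omega
        · have hd2 := seedDist_zero_of_up hf hy hadj (q - 2) (by omega) (by rw [e]; exact h')
          have hd3 := seedDist_of_le hf h'.1
          rw [h'.2] at hd3
          rw [h.2] at hd0
          omega
        · exact h'
      have := h1 hup
      omega
  have b1 : seedDist ℓ f (y (q - 1)) = 0 ∨ IsUp ℓ f (y (q - 1)) (y (q - 2)) := by
    rcases last with h | h | h
    · exact Or.inl (seedDist_of_lt h.2.1)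
    · by_cases hl : y (q - 1) < ℓ
      · exact Or.inl (seedDist_of_lt hl)
      exfalso
      have hd := seedDist_zero_of_up hf hy hadj (q - 2) (by omega) (by rw [e]; exact h)
      have hd0 := seedDist_of_le hf h.1
      rcases b0 with h' | h'
      · omega
      · have := h0 h'
        omega
    · exact Or.inr h
  have c0 : seedDist ℓ f (y 0) ≤ max r
      (min (seedPos ℓ pos f (y 0)) (ℓ - 1 - seedPos ℓ pos f (y 0)) - (2 * a + r + 1)) := by
    rcases b0 with h | h
    · omega
    · exact h0 h
  have c1 : seedDist ℓ f (y (q - 1)) ≤ max r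
      (min (seedPos ℓ pos f (y (q - 1))) (ℓ - 1 - seedPos ℓ pos f (y (q - 1))) -
        (2 * a + r + 1)) := by
    rcases b1 with h | h
    · omega
    · exact h1 h
  clear h0 h1 b0 b1 hoff last
  generalize seedDist ℓ f (y 0) = D at *
  generalize seedDist ℓ f (y (q - 1)) = D' at *
  generalize seedPos ℓ pos f (y 0) = P at *
  generalize seedPos ℓ pos f (y (q - 1)) = P' at *
  -- If `D > r`, the excess bound at the first end and `D' ≤ r + min P' (ℓ - 1 - P')` give `D + D' +
  -- |P - P'| ≤ ℓ - 1 - (2 * a + r + 1) + r = q - 2`, one short of the `q - 1` steps. This fixes the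
  -- shift `2 * a + r + 1`.
  have hD : D ≤ r := by
    by_contra hD
    have : D ≤ min P (ℓ - 1 - P) - (2 * a + r + 1) := by omega
    have : D' ≤ r + (ℓ - 1 - P') := by omega
    have : D' ≤ r + P' := by omega
    omega
  have hD' : D' ≤ r := by
    by_contra hD
    have : D' ≤ min P' (ℓ - 1 - P') - (2 * a + r + 1) := by omega
    have : D ≤ r + (ℓ - 1 - P) := by omega
    have : D ≤ r + P := by omega
    omega
  omega

end Path

/-! ### Path cores and the algorithm. -/

/-- Cutting the edge from `u` to `v` separates a set of at least `K` vertices containing `u`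
from `v`. -/
def HasEndCut {V : Type*} (G : SimpleGraph V) (K : ℕ) (u v : V) : Prop :=
  ∃ W : Finset V, K ≤ W.card ∧ u ∈ W ∧ v ∉ W ∧ ∀ a ∈ W, ∀ b, b ∉ W → G.Adj a b → a = u ∧ b = v

/-- `H` is what remains of the vertices of a path on `q` vertices after the removal of `r` vertices
at either end, where the end edges of the path cut off at least `K` vertices each. -/
def IsPathCore {V : Type*} [DecidableEq V] (G : SimpleGraph V) (K q r : ℕ) (H : Finset V) : Prop :=
  ∃ x : ℕ → V, (∀ s < q, ∀ t < q, x s = x t → s = t) ∧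
    (∀ t, t + 1 < q → G.Adj (x t) (x (t + 1))) ∧
    HasEndCut G K (x 0) (x 1) ∧ HasEndCut G K (x (q - 1)) (x (q - 2)) ∧
    H = (Finset.Ico r (q - r)).image x

section Core

variable {V : Type*} {G G' : SimpleGraph V} {K q r : ℕ} {H : Finset V}

theorem HasEndCut.map {u v : V} (h : HasEndCut G K u v) (e : V ≃ V)
    (he : ∀ a b, G'.Adj (e a) (e b) ↔ G.Adj a b) : HasEndCut G' K (e u) (e v) := by
  obtain ⟨W, hK, hu, hv, hW⟩ := h
  refine ⟨W.map e.toEmbedding, by simpa using hK, by simpa using hu, by simpa using hv, ?_⟩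
  intro a ha b hb hab
  obtain ⟨a, rfl⟩ := e.surjective a
  obtain ⟨b, rfl⟩ := e.surjective b
  have := hW a (by simpa using ha) b (by simpa using hb) ((he a b).1 hab)
  simpa using this

variable [DecidableEq V]

theorem IsPathCore.map (h : IsPathCore G K q r H) (e : V ≃ V)
    (he : ∀ a b, G'.Adj (e a) (e b) ↔ G.Adj a b) :
    IsPathCore G' K q r (H.map e.toEmbedding) := by
  obtain ⟨x, hx, hadj, h0, h1, rfl⟩ := h
  refine ⟨e ∘ x, fun s hs t ht hst => hx s hs t ht (e.injective hst),
    fun t ht => (he _ _).2 (hadj t ht), h0.map e he, h1.map e he, ?_⟩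
  rw [Finset.map_eq_image, Finset.image_image]
  rfl

theorem IsPathCore.card (h : IsPathCore G K q r H) : H.card = q - 2 * r := by
  obtain ⟨x, hx, -, -, -, rfl⟩ := h
  rw [Finset.card_image_of_injOn, Nat.card_Ico]
  · omega
  · intro s hs t ht hst
    simp only [Finset.coe_Ico, Set.mem_Ico] at hs ht
    exact hx s (by omega) t (by omega) hst

end Core

theorem exists_finset_card_eq {n k : ℕ} (h : k ≤ n) : ∃ s : Finset (Fin n), s.card = k := by
  obtain ⟨s, -, hs⟩ := Finset.exists_subset_card_eq (s := (Finset.univ : Finset (Fin n)))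
    (n := k) (by rwa [Finset.card_univ, Fintype.card_fin])
  exact ⟨s, hs⟩

open Classical in
/-- The procedure that outputs some core of a long path if there is one. -/
noncomputable def pathCoreSelector (n K q r : ℕ) (h : q - 2 * r ≤ n) :
    VertexSelector n (q - 2 * r) where
  select G :=
    if hG : ∃ H, IsPathCore G K q r H then hG.choose else (exists_finset_card_eq h).choose
  card_select G := by
    split_ifs with hG
    · exact hG.choose_spec.card
    · exact (exists_finset_card_eq h).choose_spec

/-- Cores are carried to cores by renaming. The arbitrary choice among them may depend on the names,
but this is harmless when all cores lie in `V`. -/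
theorem pathCoreSelector_findsOnly {n K q r : ℕ} (h : q - 2 * r ≤ n) {T : SimpleGraph (Fin n)}
    {V : Finset (Fin n)} (hex : ∃ H, IsPathCore T K q r H)
    (hV : ∀ H, IsPathCore T K q r H → H ⊆ V) : (pathCoreSelector n K q r h).FindsOnly V T := by
  intro π
  obtain ⟨H, hH⟩ := hex
  have hadj : ∀ a b, (T.map π).Adj (π a) (π b) ↔ T.Adj a b := by
    intro a b
    rw [SimpleGraph.map_adj']
    constructor
    · rintro ⟨-, u, v, huv, hu, hv⟩
      rwa [← π.injective hu, ← π.injective hv]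
    · intro h
      exact ⟨π.injective.ne h.ne, a, b, h, rfl, rfl⟩
  have hex' : ∃ H, IsPathCore (T.map π) K q r H := ⟨_, hH.map π hadj⟩
  have hsel : (pathCoreSelector n K q r h).select (T.map π) = hex'.choose := dif_pos hex'
  rw [hsel]
  have hcore := hex'.choose_spec
  generalize hex'.choose = H' at hcore
  have hback := hV _ (hcore.map (G' := T) π.symm (fun a b => by rw [← hadj]; simp))
  intro v hv
  have : π.symm v ∈ V := hback (by simpa using hv)
  simpa [Finset.mem_map_equiv] using this

/-! ### Existence and soundness of cores in the grown tree. -/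

section Grown

variable {ℓ n K a r : ℕ} {pos f : ℕ → ℕ} {T : SimpleGraph (Fin n)}

/-- The cut set consists of everything hanging on the block. A vertex off the seed has the same
`seedPos` as its parent, so only seed edges can leave this set. -/
theorem hasEndCut_of_block (hf : IsParentMap ℓ f)
    (hinj : ∀ i < ℓ, ∀ j < ℓ, pos i = pos j → i = j)
    (hT : ∀ u v : Fin n, T.Adj u v ↔ GrownAdj ℓ pos f u v) {P : ℕ → Prop} [DecidablePred P]
    (hK : K ≤ ((Finset.range n).filter fun v => P (seedPos ℓ pos f v)).card) {u v : Fin n}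
    (hu : (u : ℕ) < ℓ) (hv : (v : ℕ) < ℓ)
    (hPu : P (pos u)) (hPv : ¬ P (pos v))
    (hP : ∀ i j, P i → ¬ P j → (i + 1 = j ∨ j + 1 = i) → i = pos u ∧ j = pos v) :
    HasEndCut T K u v := by
  refine ⟨((Finset.range n).filter fun v => P (seedPos ℓ pos f v)).attachFin
    (fun w hw => Finset.mem_range.1 (Finset.mem_filter.1 hw).1), ?_, ?_, ?_, ?_⟩
  · rwa [Finset.card_attachFin]
  · simpa [seedPos_of_lt hu] using hPu
  · simpa [seedPos_of_lt hv] using hPv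
  · intro x hx y hy hxy
    simp only [Finset.mem_attachFin, Finset.mem_filter, Finset.mem_range, Fin.is_lt,
      true_and] at hx hy
    rcases (hT x y).1 hxy with ⟨h1, h2, h3⟩ | ⟨h1, h2⟩ | ⟨h1, h2⟩
    · rw [seedPos_of_lt h1] at hx
      rw [seedPos_of_lt h2] at hy
      obtain ⟨e1, e2⟩ := hP _ _ hx hy h3
      exact ⟨Fin.ext (hinj _ h1 _ hu e1), Fin.ext (hinj _ h2 _ hv e2)⟩
    · rw [seedPos_of_le hf h1, h2] at hx
      exact absurd hx hy
    · rw [seedPos_of_le hf h1, h2] at hy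
      exact absurd hx hy

theorem exists_isPathCore (hf : IsParentMap ℓ f)
    (hinj : ∀ i < ℓ, ∀ j < ℓ, pos i = pos j → i = j)
    (hsurj : ∀ i < ℓ, ∃ j < ℓ, pos j = i) (hn : ℓ ≤ n)
    (hT : ∀ u v : Fin n, T.Adj u v ↔ GrownAdj ℓ pos f u v) (ha : 2 * a + 1 < ℓ)
    (hleft : K ≤ ((Finset.range n).filter fun v => seedPos ℓ pos f v ≤ a).card)
    (hright : K ≤ ((Finset.range n).filter fun v => ℓ ≤ seedPos ℓ pos f v + a + 1).card) :
    ∃ H, IsPathCore T K (ℓ - 2 * a) r H := by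
  have hex : ∀ t, ∃ v : Fin n, (v : ℕ) < ℓ ∧ (t < ℓ - 2 * a → pos v = a + t) := by
    intro t
    by_cases ht : t < ℓ - 2 * a
    · obtain ⟨j, hj, hjt⟩ := hsurj (a + t) (by omega)
      exact ⟨⟨j, by omega⟩, hj, fun _ => hjt⟩
    -- A filler value: positions outside the window are never used.
    · exact ⟨⟨0, by omega⟩, by simp only; omega, fun h => absurd h ht⟩
  choose x hx hxpos using hex
  refine ⟨_, x, ?_, ?_, ?_, ?_, rfl⟩
  · intro s hs t ht hst
    have h1 := hxpos s hs
    have h2 := hxpos t ht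
    rw [hst] at h1
    omega
  · intro t ht
    rw [hT]
    have h1 := hxpos t (by omega)
    have h2 := hxpos _ ht
    exact Or.inl ⟨hx _, hx _, Or.inl (by omega)⟩
  · have h1 := hxpos 0 (by omega)
    have h2 := hxpos 1 (by omega)
    refine hasEndCut_of_block hf hinj hT (P := fun i => i ≤ a) hleft (hx _) (hx _) ?_ ?_ ?_
    · omega
    · omega
    · omega
  · have h1 := hxpos (ℓ - 2 * a - 1) (by omega)
    have h2 := hxpos (ℓ - 2 * a - 2) (by omega)
    refine hasEndCut_of_block hf hinj hT (P := fun i => ℓ ≤ i + a + 1) hright (hx _) (hx _)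
      ?_ ?_ ?_
    · omega
    · omega
    · omega

theorem HasEndCut.le_subtreeSize (hf : IsParentMap ℓ f)
    (hinj : ∀ i < ℓ, ∀ j < ℓ, pos i = pos j → i = j)
    (hsurj : ∀ i < ℓ, ∃ j < ℓ, pos j = i) (hpos : ∀ i < ℓ, pos i < ℓ) (hn : ℓ ≤ n)
    (hT : ∀ u v : Fin n, T.Adj u v ↔ GrownAdj ℓ pos f u v) {u v : Fin n}
    (h : HasEndCut T K u v) (hup : IsUp ℓ f u v) : K ≤ subtreeSize ℓ f n u := by
  obtain ⟨W, hK, hu, hv, hW⟩ := h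
  refine hK.trans ?_
  rw [subtreeSize, ← Finset.card_map Fin.valEmbedding]
  refine Finset.card_le_card fun w hw => ?_
  obtain ⟨w, hmem, rfl⟩ := Finset.mem_map.1 hw
  rw [Finset.mem_filter, Finset.mem_range]
  refine ⟨w.2, ?_⟩
  have hfu : f u < n := by rw [hup.2]; exact v.2
  refine mem_branch_of_mem_cut (W := fun i => ∃ hi : i < n, (⟨i, hi⟩ : Fin n) ∈ W) hf hinj hsurj
    hpos hn hup.1 u.2 ?_ ?_ w.2 ⟨w.2, hmem⟩
  · rintro ⟨hi, hmem⟩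
    apply hv
    convert hmem
    exact hup.2.symm
  · rintro i hi j hj ⟨_, hiW⟩ hjW hij
    have := hW ⟨i, hi⟩ hiW ⟨j, hj⟩ (fun hc => hjW ⟨hj, hc⟩) ((hT _ _).2 hij)
    rw [hup.2]
    exact ⟨congrArg Fin.val this.1, congrArg Fin.val this.2⟩

theorem IsPathCore.lt_of_mem (hf : IsParentMap ℓ f)
    (hinj : ∀ i < ℓ, ∀ j < ℓ, pos i = pos j → i = j)
    (hsurj : ∀ i < ℓ, ∃ j < ℓ, pos j = i) (hpos : ∀ i < ℓ, pos i < ℓ) (hn : ℓ ≤ n)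
    (hT : ∀ u v : Fin n, T.Adj u v ↔ GrownAdj ℓ pos f u v) (ha : 2 * a + r + 1 < ℓ)
    (hsmall : ∀ v < n, ℓ ≤ v → K ≤ subtreeSize ℓ f n v → seedDist ℓ f v ≤ max r
      (min (seedPos ℓ pos f v) (ℓ - 1 - seedPos ℓ pos f v) - (2 * a + r + 1)))
    {H : Finset (Fin n)} (hH : IsPathCore T K (ℓ - 2 * a) r H) {v : Fin n} (hv : v ∈ H) :
    (v : ℕ) < ℓ := by
  obtain ⟨x, hx, hadj, h0, h1, rfl⟩ := hH
  obtain ⟨t, ht, rfl⟩ := Finset.mem_image.1 hv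
  rw [Finset.mem_Ico] at ht
  refine path_inner_lt (q := ℓ - 2 * a) (a := a) (r := r) (y := fun t => (x t : ℕ)) hf hinj hpos
    (fun s hs t ht hst => hx s hs t ht (Fin.ext hst)) (fun t ht => (hT _ _).1 (hadj t ht))
    (by omega) (by omega) (fun hup => ?_) (fun hup => ?_) ht.1 (by omega)
  · exact hsmall _ (x 0).2 hup.1 (h0.le_subtreeSize hf hinj hsurj hpos hn hT hup)
  · exact hsmall _ (x _).2 hup.1 (h1.le_subtreeSize hf hinj hsurj hpos hn hT hup)

end Grown

/-! ### From supermartingales to probabilities. -/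

section Law

theorem PMF.tsum_bind_mul {α β : Type*} (p : PMF α) (g : α → PMF β) (G : β → ENNReal) :
    ∑' b, p.bind g b * G b = ∑' a, p a * ∑' b, g a b * G b := by
  simp_rw [PMF.bind_apply, ← ENNReal.tsum_mul_right, ← ENNReal.tsum_mul_left]
  rw [ENNReal.tsum_comm]
  simp_rw [mul_assoc]

theorem PMF.tsum_pure_mul {α : Type*} (a : α) (G : α → ENNReal) :
    ∑' b, PMF.pure a b * G b = G a := by
  rw [tsum_eq_single a]
  · simp
  · intro b hb
    rw [PMF.pure_apply_of_ne _ _ hb, zero_mul]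

theorem ofReal_sum_le {ι : Type*} (s : Finset ι) (g : ι → ℝ) :
    ENNReal.ofReal (∑ i ∈ s, g i) ≤ ∑ i ∈ s, ENNReal.ofReal (g i) := by
  classical
  induction s using Finset.induction_on with
  | empty => simp
  | insert a s ha ih =>
    rw [Finset.sum_insert ha, Finset.sum_insert ha]
    exact ENNReal.ofReal_add_le.trans (add_le_add le_rfl ih)

variable {ℓ : ℕ} {pos f : ℕ → ℕ}

theorem IsParentMap.update (hf : IsParentMap ℓ f) {n p : ℕ} (hp : p < n) :
    IsParentMap ℓ (Function.update f n p) := by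
  intro v hv
  rw [Function.update_apply]
  split_ifs with h
  · omega
  · exact hf v hv

theorem attachVertex_grownAdj {n : ℕ} (hn : ℓ ≤ n) {T : SimpleGraph (Fin n)}
    (hT : ∀ u v : Fin n, T.Adj u v ↔ GrownAdj ℓ pos f u v) (hf : IsParentMap ℓ f) (p : Fin n)
    (u v : Fin (n + 1)) :
    (attachVertex T p).Adj u v ↔ GrownAdj ℓ pos (Function.update f n p) u v := by
  have hold : ∀ u v : Fin n, (attachVertex T p).Adj u.castSucc v.castSucc ↔ T.Adj u v := by
    intro u v
    rw [attachVertex, SimpleGraph.sup_adj, SimpleGraph.edge_adj, SimpleGraph.map_adj']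
    constructor
    · rintro (⟨-, u', v', h, hu, hv⟩ | ⟨⟨-, h⟩ | ⟨h, -⟩, -⟩)
      · rwa [← Fin.castSucc_injective n hu, ← Fin.castSucc_injective n hv]
      · exact absurd h (Fin.castSucc_lt_last v).ne
      · exact absurd h (Fin.castSucc_lt_last u).ne
    · intro h
      exact Or.inl ⟨fun hc => h.ne (Fin.castSucc_injective n hc), u, v, h, rfl, rfl⟩
  have hnew : ∀ u : Fin n, (attachVertex T p).Adj u.castSucc (Fin.last n) ↔ u = p := by
    intro u
    rw [attachVertex, SimpleGraph.sup_adj, SimpleGraph.edge_adj, SimpleGraph.map_adj']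
    constructor
    · rintro (⟨-, u', v', h, hu, hv⟩ | ⟨⟨h, -⟩ | ⟨h, -⟩, -⟩)
      · exact absurd hv (Fin.castSucc_lt_last v').ne
      · exact Fin.castSucc_injective n h
      · exact absurd h (Fin.castSucc_lt_last u).ne
    · rintro rfl
      exact Or.inr ⟨Or.inl ⟨rfl, rfl⟩, (Fin.castSucc_lt_last u).ne⟩
  have hnew' : ∀ u : Fin n, GrownAdj ℓ pos (Function.update f n p) u n ↔ u = p := by
    intro u
    have hu := u.2
    have hfu : ℓ ≤ (u : ℕ) → f u < u := hf u
    unfold GrownAdj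
    rw [Function.update_self, Function.update_of_ne hu.ne]
    constructor
    · rintro (h | h | h)
      · omega
      · have := hfu h.1
        omega
      · exact Fin.ext h.2.symm
    · rintro rfl
      exact Or.inr (Or.inr ⟨hn, rfl⟩)
  have hsymm : ∀ a b, GrownAdj ℓ pos (Function.update f n p) a b ↔
      GrownAdj ℓ pos (Function.update f n p) b a := fun a b => ⟨.symm, .symm⟩
  induction u using Fin.lastCases with
  | last =>
    induction v using Fin.lastCases with
    | last =>
      rw [Fin.val_last]
      constructor
      · intro h
        exact absurd rfl h.ne
      · intro h
        exfalso
        unfold GrownAdj at h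
        rw [Function.update_self] at h
        omega
    | cast v =>
      rw [SimpleGraph.adj_comm, hsymm, hnew]
      exact (hnew' v).symm
  | cast u =>
    induction v using Fin.lastCases with
    | last =>
      rw [hnew]
      exact (hnew' u).symm
    | cast v =>
      rw [hold, hT, Fin.val_castSucc, Fin.val_castSucc]
      unfold GrownAdj
      rw [Function.update_of_ne u.2.ne, Function.update_of_ne v.2.ne]

/-- A functional of the growth of the tree whose conditional mean never increases bounds the
failure probability. -/
theorem le_tsum_uniformAttachment [NeZero ℓ] {S : SimpleGraph (Fin ℓ)}
    (hS : ∀ u v : Fin ℓ, S.Adj u v ↔ (pos u + 1 = pos v ∨ pos v + 1 = pos u))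
    {Φ : ℕ → (ℕ → ℕ) → ℝ}
    (hΦ : ∀ n, ℓ ≤ n → ∀ f, IsParentMap ℓ f →
      ∑ p ∈ Finset.range n, Φ (n + 1) (Function.update f n p) ≤ n * Φ n f)
    {f₀ : ℕ → ℕ} (hf₀ : IsParentMap ℓ f₀) (d : ℕ) (G : SimpleGraph (Fin (ℓ + d)) → ENNReal)
    (hG : ∀ (f : ℕ → ℕ) (T : SimpleGraph (Fin (ℓ + d))), IsParentMap ℓ f →
      (∀ u v : Fin (ℓ + d), T.Adj u v ↔ GrownAdj ℓ pos f u v) →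
      ENNReal.ofReal (1 - Φ (ℓ + d) f) ≤ G T) :
    ENNReal.ofReal (1 - Φ ℓ f₀) ≤ ∑' T, uniformAttachment S d T * G T := by
  induction d with
  | zero =>
    refine (hG f₀ S hf₀ fun u v => ?_).trans (PMF.tsum_pure_mul S G).ge
    rw [hS]
    have hu : (u : ℕ) < ℓ := u.2
    have hv : (v : ℕ) < ℓ := v.2
    unfold GrownAdj
    constructor
    · exact fun h => Or.inl ⟨hu, hv, h⟩
    · rintro (h | h | h)
      · exact h.2.2
      · omega
      · omega
  | succ d ih =>
    have : Nonempty (Fin (ℓ + d)) := ⟨Fin.castAdd d 0⟩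
    have hpos : 0 < ((ℓ + d : ℕ) : ℝ) := by
      have := Nat.pos_of_ne_zero (NeZero.ne ℓ)
      exact_mod_cast (by omega : 0 < ℓ + d)
    have hstep : ∑' T, uniformAttachment S (d + 1) T * G T =
        ∑' T, uniformAttachment S d T *
          ∑ p : Fin (ℓ + d), ((ℓ + d : ℕ) : ENNReal)⁻¹ * G (attachVertex T p) := by
      change ∑' T, ((uniformAttachment S d).bind fun T =>
        (PMF.uniformOfFintype (Fin (ℓ + d))).bind fun p => PMF.pure (attachVertex T p)) T * G T = _
      rw [PMF.tsum_bind_mul]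
      refine tsum_congr fun T => ?_
      rw [PMF.tsum_bind_mul, tsum_fintype]
      congr 1
      refine Finset.sum_congr rfl fun p _ => ?_
      rw [PMF.tsum_pure_mul, PMF.uniformOfFintype_apply, Fintype.card_fin]
    rw [hstep]
    -- The test function for `d` vertices is the mean of `G` over the next attachment, so the
    -- induction runs backwards in time and the potential need only be averaged over one step.
    refine ih _ fun f T hf hT => ?_
    have hsum := hΦ (ℓ + d) (by omega) f hf
    rw [← Fin.sum_univ_eq_sum_range
      (fun p => Φ (ℓ + d + 1) (Function.update f (ℓ + d) p))] at hsum
    calc ENNReal.ofReal (1 - Φ (ℓ + d) f)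
        ≤ ENNReal.ofReal (∑ p : Fin (ℓ + d), ((ℓ + d : ℕ) : ℝ)⁻¹ *
            (1 - Φ (ℓ + d + 1) (Function.update f (ℓ + d) p))) := by
          apply ENNReal.ofReal_le_ofReal
          rw [← Finset.mul_sum, Finset.sum_sub_distrib, Finset.sum_const, Finset.card_univ,
            Fintype.card_fin, nsmul_eq_mul, mul_one, le_inv_mul_iff₀ hpos]
          linarith
      _ ≤ ∑ p : Fin (ℓ + d), ENNReal.ofReal (((ℓ + d : ℕ) : ℝ)⁻¹ *
            (1 - Φ (ℓ + d + 1) (Function.update f (ℓ + d) p))) := ofReal_sum_le _ _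
      _ ≤ _ := by
          refine Finset.sum_le_sum fun p _ => ?_
          rw [ENNReal.ofReal_mul (by positivity), ENNReal.ofReal_inv_of_pos hpos,
            ENNReal.ofReal_natCast]
          gcongr
          exact hG _ _ (hf.update p.2) (attachVertex_grownAdj (by omega) hT hf p)

end Law

/-! ### Effect of one attachment on the tree statistics. -/

section Update

variable {ℓ : ℕ} {pos f : ℕ → ℕ} {n p : ℕ}

theorem seedDist_update {v : ℕ} (hv : v < n) :
    seedDist ℓ (Function.update f n p) v = seedDist ℓ f v := by
  induction v using Nat.strong_induction_on with
  | _ v ih =>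
    rw [seedDist.eq_def ℓ (Function.update f n p) v, seedDist.eq_def ℓ f v,
      Function.update_of_ne hv.ne]
    split_ifs with h
    · rw [ih _ h.2 (by omega)]
    · rfl

theorem seedPos_update {v : ℕ} (hv : v < n) :
    seedPos ℓ pos (Function.update f n p) v = seedPos ℓ pos f v := by
  induction v using Nat.strong_induction_on with
  | _ v ih =>
    rw [seedPos.eq_def ℓ pos (Function.update f n p) v, seedPos.eq_def ℓ pos f v,
      Function.update_of_ne hv.ne]
    split_ifs with h
    · rw [ih _ h.2 (by omega)]
    · rfl

theorem branch_update {v : ℕ} (hv : v < n) :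
    branch ℓ (Function.update f n p) v = branch ℓ f v := by
  induction v using Nat.strong_induction_on with
  | _ v ih =>
    rw [branch.eq_def ℓ (Function.update f n p) v, branch.eq_def ℓ f v,
      Function.update_of_ne hv.ne]
    split_ifs with h
    · rw [ih _ h.2 (by omega)]
    · rfl

theorem seedDist_update_self (hn : ℓ ≤ n) (hp : p < n) :
    seedDist ℓ (Function.update f n p) n = seedDist ℓ f p + 1 := by
  rw [seedDist, Function.update_self, if_pos ⟨hn, hp⟩, seedDist_update hp]

theorem seedPos_update_self (hn : ℓ ≤ n) (hp : p < n) :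
    seedPos ℓ pos (Function.update f n p) n = seedPos ℓ pos f p := by
  rw [seedPos, Function.update_self, if_pos ⟨hn, hp⟩, seedPos_update hp]

theorem branch_update_self (hn : ℓ ≤ n) (hp : p < n) :
    branch ℓ (Function.update f n p) n = insert n (branch ℓ f p) := by
  rw [branch, Function.update_self, if_pos ⟨hn, hp⟩, branch_update hp]

theorem subtreeSize_update (hn : ℓ ≤ n) (hp : p < n) {v : ℕ} (hv : v < n) :
    subtreeSize ℓ (Function.update f n p) (n + 1) v =
      subtreeSize ℓ f n v + if v ∈ branch ℓ f p then 1 else 0 := by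
  simp only [subtreeSize, Finset.card_filter]
  rw [Finset.sum_range_succ, branch_update_self hn hp]
  congr 1
  · refine Finset.sum_congr rfl fun w hw => ?_
    rw [branch_update (Finset.mem_range.1 hw)]
  · simp [hv.ne]

theorem subtreeSize_update_self (hn : ℓ ≤ n) (hp : p < n) :
    subtreeSize ℓ (Function.update f n p) (n + 1) n = 1 := by
  simp only [subtreeSize, Finset.card_filter]
  rw [Finset.sum_range_succ, branch_update_self hn hp, if_pos (Finset.mem_insert_self _ _),
    Finset.sum_eq_zero]
  intro w hw
  have hw := Finset.mem_range.1 hw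
  rw [branch_update hw, if_neg]
  intro h
  have := mem_branch_le f w n h
  omega

end Update

/-! ### Urn martingale for the end blocks. -/

section Block

variable {ℓ : ℕ} {pos f : ℕ → ℕ} {n : ℕ}

/-- The number of vertices below `n` that hang on seed vertices whose position satisfies `P`. -/
def blockSize (ℓ : ℕ) (pos : ℕ → ℕ) (P : ℕ → Prop) [DecidablePred P] (n : ℕ) (f : ℕ → ℕ) : ℕ :=
  ((Finset.range n).filter fun v => P (seedPos ℓ pos f v)).card

variable {P : ℕ → Prop} [DecidablePred P]

theorem blockSize_update (hn : ℓ ≤ n) {p : ℕ} (hp : p < n) :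
    blockSize ℓ pos P (n + 1) (Function.update f n p) =
      blockSize ℓ pos P n f + if P (seedPos ℓ pos f p) then 1 else 0 := by
  simp only [blockSize, Finset.card_filter]
  rw [Finset.sum_range_succ, seedPos_update_self hn hp]
  congr 1
  refine Finset.sum_congr rfl fun w hw => ?_
  rw [seedPos_update (Finset.mem_range.1 hw)]

theorem blockSize_mono (hn : ℓ ≤ n) : blockSize ℓ pos P ℓ f ≤ blockSize ℓ pos P n f :=
  Finset.card_le_card (Finset.filter_subset_filter _ (Finset.range_subset_range.2 hn))

theorem blockSize_seed : blockSize ℓ pos P ℓ f = ((Finset.range ℓ).filter fun v => P (pos v)).card := by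
  unfold blockSize
  congr 1
  refine Finset.filter_congr fun v hv => ?_
  rw [seedPos_of_lt (Finset.mem_range.1 hv)]

/-- The martingale that controls the lower tail of the size of a block of `a + 1` seed vertices
with the trees hanging on them. -/
noncomputable def blockPotential (ℓ : ℕ) (pos : ℕ → ℕ) (P : ℕ → Prop) [DecidablePred P] (a n : ℕ)
    (f : ℕ → ℕ) : ℝ :=
  ((n - 1).choose a : ℝ) / ((blockSize ℓ pos P n f - 1).choose a : ℝ)

/-- With block size `s`, the identity `s * C(s-1,a) / C(s,a) = s - a` turns the sum over parents
inside and outside the block into `(n - a) * C(n,a) / C(s-1,a)`, and `(n - a) * C(n,a) = n *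
C(n-1,a)`. The hypothesis `ha` keeps the denominators nonzero. -/
theorem sum_blockPotential {a : ℕ}
    (ha : a < ((Finset.range ℓ).filter fun v => P (pos v)).card) (hn : ℓ ≤ n) :
    ∑ p ∈ Finset.range n, blockPotential ℓ pos P a (n + 1) (Function.update f n p) =
      n * blockPotential ℓ pos P a n f := by
  have hs : a < blockSize ℓ pos P n f := by
    rw [← blockSize_seed (f := f)] at ha
    exact ha.trans_le (blockSize_mono hn)
  have hsn : blockSize ℓ pos P n f ≤ n := by
    simpa [blockSize] using Finset.card_filter_le (Finset.range n)
      (fun v => P (seedPos ℓ pos f v))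
  have hsum : ∀ x y : ℝ, ∑ p ∈ Finset.range n, (if P (seedPos ℓ pos f p) then x else y) =
      blockSize ℓ pos P n f * x + (n - blockSize ℓ pos P n f) * y := by
    intro x y
    rw [Finset.sum_ite, Finset.sum_const, Finset.sum_const, nsmul_eq_mul, nsmul_eq_mul]
    have := Finset.card_filter_add_card_filter_not (s := Finset.range n)
      (fun v => P (seedPos ℓ pos f v))
    rw [Finset.card_range] at this
    have hc : (((Finset.range n).filter fun v => ¬ P (seedPos ℓ pos f v)).card : ℝ) =
        n - blockSize ℓ pos P n f := by
      rw [eq_sub_iff_add_eq', blockSize]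
      exact_mod_cast this
    rw [hc]
    rfl
  have hterm : ∀ p ∈ Finset.range n,
      blockPotential ℓ pos P a (n + 1) (Function.update f n p) =
        if P (seedPos ℓ pos f p) then (n.choose a : ℝ) / ((blockSize ℓ pos P n f).choose a : ℝ)
        else (n.choose a : ℝ) / ((blockSize ℓ pos P n f - 1).choose a : ℝ) := by
    intro p hp
    rw [blockPotential, blockSize_update hn (Finset.mem_range.1 hp)]
    split_ifs <;> simp
  rw [Finset.sum_congr rfl hterm, hsum, blockPotential]
  generalize blockSize ℓ pos P n f = s at hs hsn
  obtain ⟨s, rfl⟩ : ∃ t, s = t + 1 := ⟨s - 1, by omega⟩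
  obtain ⟨N, rfl⟩ : ∃ t, n = t + 1 := ⟨n - 1, by omega⟩
  simp only [Nat.add_sub_cancel]
  have h1 : (s.choose a : ℝ) * (s + 1) = (s + 1).choose a * (s + 1 - a) := by
    have := Nat.choose_mul_succ_eq s a
    have h : ((s + 1 - a : ℕ) : ℝ) = s + 1 - a := by
      rw [Nat.cast_sub (by omega)]
      push_cast
      ring
    rw [← h]
    exact_mod_cast this
  have h2 : (N.choose a : ℝ) * (N + 1) = (N + 1).choose a * (N + 1 - a) := by
    have := Nat.choose_mul_succ_eq N a
    have h : ((N + 1 - a : ℕ) : ℝ) = N + 1 - a := by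
      rw [Nat.cast_sub (by omega)]
      push_cast
      ring
    rw [← h]
    exact_mod_cast this
  have p1 : (0 : ℝ) < s.choose a := by exact_mod_cast Nat.choose_pos (by omega)
  have p2 : (0 : ℝ) < (s + 1).choose a := by exact_mod_cast Nat.choose_pos (by omega)
  push_cast
  field_simp
  linear_combination ((N + 1).choose a : ℝ) * h1 - ((s + 1).choose a : ℝ) * h2

end Block

/-! ### Weighted third-moment martingale for the subtrees. -/

section Branch

variable {ℓ : ℕ} {pos f : ℕ → ℕ} {n : ℕ} {y : ℕ → ℝ}

/-- The weight `2 ^ j` of a vertex at distance `j` from the seed, times the weight `y` of the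
position where it hangs on the seed. -/
noncomputable def vertexWeight (ℓ : ℕ) (pos : ℕ → ℕ) (y : ℕ → ℝ) (f : ℕ → ℕ) (v : ℕ) : ℝ :=
  y (seedPos ℓ pos f v) * 2 ^ seedDist ℓ f v

/-- The martingale that controls the sizes of the subtrees far from the seed. -/
noncomputable def branchPotential (ℓ : ℕ) (pos : ℕ → ℕ) (y : ℕ → ℝ) (n : ℕ) (f : ℕ → ℕ) : ℝ :=
  (∑ v ∈ Finset.range n, vertexWeight ℓ pos y f v *
    (subtreeSize ℓ f n v * (subtreeSize ℓ f n v + 1) * (subtreeSize ℓ f n v + 2) + 12)) /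
      (n * (n + 1) * (n + 2))

theorem vertexWeight_update {p v : ℕ} (hv : v < n) :
    vertexWeight ℓ pos y (Function.update f n p) v = vertexWeight ℓ pos y f v := by
  rw [vertexWeight, vertexWeight, seedPos_update hv, seedDist_update hv]

theorem vertexWeight_update_self {p : ℕ} (hn : ℓ ≤ n) (hp : p < n) :
    vertexWeight ℓ pos y (Function.update f n p) n = 2 * vertexWeight ℓ pos y f p := by
  rw [vertexWeight, vertexWeight, seedPos_update_self hn hp, seedDist_update_self hn hp, pow_succ]
  ring

/-- Summed over parents, growth of old subtrees contributes `3 * s * (s + 1) * (s + 2)` per vertex,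
and a new leaf contributes twice its parent's weight times `6 + 12`. The constant `12` solves `2 *
(6 + c) = 3 * c`, so the numerator's mean grows by exactly `(n + 3) / n`. -/
theorem sum_branchPotential (hn : ℓ ≤ n) (hn0 : 0 < n) :
    ∑ p ∈ Finset.range n, branchPotential ℓ pos y (n + 1) (Function.update f n p) =
      n * branchPotential ℓ pos y n f := by
  have hn0' : (0 : ℝ) < n := by exact_mod_cast hn0
  set w := vertexWeight ℓ pos y f with hw
  set s : ℕ → ℝ := fun v => subtreeSize ℓ f n v with hs
  have hterm : ∀ p ∈ Finset.range n, branchPotential ℓ pos y (n + 1) (Function.update f n p) =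
      ((∑ v ∈ Finset.range n, w v * (s v * (s v + 1) * (s v + 2) + 12)) +
        (∑ v ∈ Finset.range n, w v * (3 * (s v + 1) * (s v + 2) *
          if v ∈ branch ℓ f p then 1 else 0)) + 36 * w p) / ((n + 1) * (n + 2) * (n + 3)) := by
    intro p hp
    have hp := Finset.mem_range.1 hp
    rw [branchPotential, Finset.sum_range_succ, subtreeSize_update_self hn hp,
      vertexWeight_update_self hn hp, ← Finset.sum_add_distrib]
    push_cast
    congr 1
    · congr 1
      · refine Finset.sum_congr rfl fun v hv => ?_
        have hv := Finset.mem_range.1 hv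
        rw [vertexWeight_update hv, subtreeSize_update hn hp hv]
        split_ifs <;> push_cast <;> simp only [hs, hw] <;> ring
      · ring
    · ring
  rw [Finset.sum_congr rfl hterm, ← Finset.sum_div, Finset.sum_add_distrib,
    Finset.sum_add_distrib, Finset.sum_const, Finset.card_range, nsmul_eq_mul, Finset.sum_comm,
    ← Finset.mul_sum]
  have hinner : ∀ v ∈ Finset.range n, ∑ p ∈ Finset.range n,
      w v * (3 * (s v + 1) * (s v + 2) * if v ∈ branch ℓ f p then 1 else 0) =
        3 * (w v * (s v * (s v + 1) * (s v + 2) + 12)) - 36 * w v := by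
    intro v _
    have hcount : ∑ p ∈ Finset.range n, (if v ∈ branch ℓ f p then (1 : ℝ) else 0) = s v := by
      simp only [hs, subtreeSize, Finset.card_filter]
      push_cast
      rfl
    rw [← Finset.mul_sum, ← Finset.mul_sum, hcount]
    ring
  rw [Finset.sum_congr rfl hinner, Finset.sum_sub_distrib, ← Finset.mul_sum, ← Finset.mul_sum,
    branchPotential]
  change _ = (n : ℝ) * ((∑ v ∈ Finset.range n, w v * (s v * (s v + 1) * (s v + 2) + 12)) / _)
  field_simp
  ring

end Branch

/-! ### Initial values of the potentials and their values on bad events. -/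

section Bounds

variable {ℓ : ℕ} {pos f : ℕ → ℕ} {n : ℕ}

theorem sum_comp_pos {M : Type*} [AddCommMonoid M]
    (hinj : ∀ i < ℓ, ∀ j < ℓ, pos i = pos j → i = j)
    (hsurj : ∀ i < ℓ, ∃ j < ℓ, pos j = i) (hpos : ∀ i < ℓ, pos i < ℓ) (F : ℕ → M) :
    ∑ v ∈ Finset.range ℓ, F (pos v) = ∑ i ∈ Finset.range ℓ, F i := by
  refine Finset.sum_bij (fun v _ => pos v) ?_ ?_ ?_ ?_
  · simpa using hpos
  · intro i hi j hj h
    exact hinj i (Finset.mem_range.1 hi) j (Finset.mem_range.1 hj) h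
  · intro i hi
    obtain ⟨j, hj, h⟩ := hsurj i (Finset.mem_range.1 hi)
    exact ⟨j, Finset.mem_range.2 hj, h⟩
  · intros
    rfl

theorem card_filter_pos (hinj : ∀ i < ℓ, ∀ j < ℓ, pos i = pos j → i = j)
    (hsurj : ∀ i < ℓ, ∃ j < ℓ, pos j = i) (hpos : ∀ i < ℓ, pos i < ℓ) (P : ℕ → Prop)
    [DecidablePred P] : ((Finset.range ℓ).filter fun v => P (pos v)).card =
      ((Finset.range ℓ).filter P).card := by
  rw [Finset.card_filter, Finset.card_filter]
  exact sum_comp_pos hinj hsurj hpos fun i => if P i then 1 else 0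

/-- Factor by factor: `(s - j) / (N - j) ≤ 3 / ℓ` persists as `j` grows because `3 / ℓ ≤ 1`. -/
theorem choose_mul_pow_le {s N : ℕ} (hℓ : 3 ≤ ℓ) (h : s * ℓ ≤ 3 * N) {a : ℕ} (ha : a ≤ s) :
    s.choose a * ℓ ^ a ≤ N.choose a * 3 ^ a := by
  have key : s.descFactorial a * ℓ ^ a ≤ N.descFactorial a * 3 ^ a := by
    induction a with
    | zero => simp
    | succ a ih =>
      have ih := ih (by omega)
      have hstep : (s - a) * ℓ ≤ (N - a) * 3 := by
        have h1 : 3 * a ≤ a * ℓ := by nlinarith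
        rw [Nat.sub_mul, Nat.sub_mul]
        omega
      rw [Nat.descFactorial_succ, Nat.descFactorial_succ, pow_succ, pow_succ]
      calc (s - a) * s.descFactorial a * (ℓ ^ a * ℓ)
          = ((s - a) * ℓ) * (s.descFactorial a * ℓ ^ a) := by ring
        _ ≤ ((N - a) * 3) * (N.descFactorial a * 3 ^ a) := Nat.mul_le_mul hstep ih
        _ = _ := by ring
  rw [Nat.descFactorial_eq_factorial_mul_choose, Nat.descFactorial_eq_factorial_mul_choose,
    mul_assoc, mul_assoc] at key
  exact Nat.le_of_mul_le_mul_left key (Nat.factorial_pos a)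

theorem blockPotential_nonneg {P : ℕ → Prop} [DecidablePred P] {a : ℕ} :
    0 ≤ blockPotential ℓ pos P a n f := by
  unfold blockPotential
  positivity

theorem blockPotential_seed_le {P : ℕ → Prop} [DecidablePred P] {a : ℕ} (hℓ : 0 < ℓ)
    (ha : ((Finset.range ℓ).filter fun v => P (pos v)).card = a + 1) :
    (3 / ℓ : ℝ) ^ a * blockPotential ℓ pos P a ℓ f ≤ 3 ^ a / a.factorial := by
  have hℓ' : (0 : ℝ) < ℓ := by exact_mod_cast hℓ
  rw [blockPotential, blockSize_seed, ha, Nat.add_sub_cancel, Nat.choose_self, Nat.cast_one,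
    div_one]
  have h1 : ((ℓ - 1).choose a : ℝ) ≤ (ℓ : ℝ) ^ a / a.factorial :=
    le_trans (by exact_mod_cast Nat.choose_le_choose a (Nat.sub_le ℓ 1))
      (Nat.choose_le_pow_div (α := ℝ) a ℓ)
  calc (3 / ℓ : ℝ) ^ a * ((ℓ - 1).choose a : ℝ)
      ≤ (3 / ℓ : ℝ) ^ a * ((ℓ : ℝ) ^ a / a.factorial) := by gcongr
    _ = 3 ^ a / a.factorial := by
      rw [div_pow]
      field_simp

theorem one_le_blockPotential {P : ℕ → Prop} [DecidablePred P] {a : ℕ} (hℓ : 3 ≤ ℓ)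
    (hn : ℓ ≤ n) (ha : a < ((Finset.range ℓ).filter fun v => P (pos v)).card)
    (h : blockSize ℓ pos P n f < 3 * n / ℓ + 1) :
    1 ≤ (3 / ℓ : ℝ) ^ a * blockPotential ℓ pos P a n f := by
  have hs : a < blockSize ℓ pos P n f := by
    rw [← blockSize_seed (f := f)] at ha
    exact ha.trans_le (blockSize_mono hn)
  have hmul : blockSize ℓ pos P n f * ℓ ≤ 3 * n :=
    (Nat.mul_le_mul_right ℓ (Nat.lt_succ_iff.1 h)).trans (Nat.div_mul_le_self _ _)
  rw [blockPotential]
  generalize blockSize ℓ pos P n f = s at hs hmul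
  have hsub : (s - 1) * ℓ ≤ 3 * (n - 1) := by
    rw [Nat.sub_mul]
    omega
  have key := choose_mul_pow_le hℓ hsub (a := a) (by omega)
  have hℓ' : (0 : ℝ) < ℓ := by exact_mod_cast (by omega : 0 < ℓ)
  have hc : (0 : ℝ) < (s - 1).choose a := by exact_mod_cast Nat.choose_pos (by omega)
  rw [div_pow, div_mul_div_comm, one_le_div (by positivity)]
  have key' : ((s - 1).choose a : ℝ) * ℓ ^ a ≤ (n - 1).choose a * 3 ^ a := by exact_mod_cast key
  linarith

theorem vertexWeight_nonneg {y : ℕ → ℝ} (hy : ∀ i, 0 ≤ y i) (v : ℕ) :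
    0 ≤ vertexWeight ℓ pos y f v :=
  mul_nonneg (hy _) (by positivity)

theorem branchPotential_nonneg {y : ℕ → ℝ} (hy : ∀ i, 0 ≤ y i) :
    0 ≤ branchPotential ℓ pos y n f :=
  div_nonneg (Finset.sum_nonneg fun v _ => mul_nonneg (vertexWeight_nonneg hy v) (by positivity))
    (by positivity)

theorem branchPotential_seed_le {y : ℕ → ℝ} (hy : ∀ i, 0 ≤ y i) (hℓ : 0 < ℓ)
    (hinj : ∀ i < ℓ, ∀ j < ℓ, pos i = pos j → i = j)
    (hsurj : ∀ i < ℓ, ∃ j < ℓ, pos j = i) (hpos : ∀ i < ℓ, pos i < ℓ) :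
    (ℓ / 3 : ℝ) ^ 3 * branchPotential ℓ pos y ℓ f ≤ 4 / 9 * ∑ i ∈ Finset.range ℓ, y i := by
  have hℓ' : (0 : ℝ) < ℓ := by exact_mod_cast hℓ
  have hterm : ∀ v ∈ Finset.range ℓ, vertexWeight ℓ pos y f v *
      (subtreeSize ℓ f ℓ v * (subtreeSize ℓ f ℓ v + 1) * (subtreeSize ℓ f ℓ v + 2) + 12) =
        12 * y (pos v) := by
    intro v hv
    have hv := Finset.mem_range.1 hv
    have hs : subtreeSize ℓ f ℓ v = 0 := by
      rw [subtreeSize, Finset.card_eq_zero, Finset.filter_eq_empty_iff]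
      intro w hw
      rw [branch_of_lt (Finset.mem_range.1 hw)]
      exact Finset.notMem_empty v
    rw [vertexWeight, seedPos_of_lt hv, seedDist_of_lt hv, hs]
    push_cast
    ring
  rw [branchPotential, Finset.sum_congr rfl hterm, ← Finset.mul_sum,
    sum_comp_pos hinj hsurj hpos]
  have hY : 0 ≤ ∑ i ∈ Finset.range ℓ, y i := Finset.sum_nonneg fun i _ => hy i
  generalize ∑ i ∈ Finset.range ℓ, y i = Y at hY
  calc (ℓ / 3 : ℝ) ^ 3 * (12 * Y / (ℓ * (ℓ + 1) * (ℓ + 2)))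
      ≤ (ℓ / 3 : ℝ) ^ 3 * (12 * Y / (ℓ * ℓ * ℓ)) := by
        gcongr <;> linarith
    _ = 4 / 9 * Y := by
        field_simp
        ring

theorem one_le_branchPotential {g : ℕ → ℕ} (hℓ : 3 ≤ ℓ) {v : ℕ}
    (hv : v < n) (hs : 3 * n / ℓ + 1 ≤ subtreeSize ℓ f n v)
    (hg : g (seedPos ℓ pos f v) < seedDist ℓ f v) :
    1 ≤ (ℓ / 3 : ℝ) ^ 3 * branchPotential ℓ pos (fun i => (1 / 2) ^ (g i + 1)) n f := by
  have hℓ' : (3 : ℝ) ≤ ℓ := by exact_mod_cast hℓ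
  have hn' : (0 : ℝ) < n := by exact_mod_cast (by omega : 0 < n)
  have hmul : 3 * (n : ℝ) ≤ subtreeSize ℓ f n v * ℓ := by
    have h1 : 3 * n < (3 * n / ℓ + 1) * ℓ := by
      rw [mul_comm _ ℓ]
      exact Nat.lt_mul_div_succ _ (by omega)
    exact_mod_cast h1.le.trans (Nat.mul_le_mul_right ℓ hs)
  -- Distance at least `g + 1` cancels the factor `(1 / 2) ^ (g + 1)`.
  have hw : 1 ≤ vertexWeight ℓ pos (fun i => (1 / 2) ^ (g i + 1)) f v := by
    obtain ⟨t, ht⟩ := Nat.exists_eq_add_of_lt hg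
    rw [vertexWeight, ht, show g (seedPos ℓ pos f v) + t + 1 = g (seedPos ℓ pos f v) + 1 + t by ring,
      pow_add 2, ← mul_assoc, ← mul_pow]
    norm_num
    exact one_le_pow₀ (by norm_num)
  have hsingle := Finset.single_le_sum
    (f := fun v => vertexWeight ℓ pos (fun i => (1 / 2) ^ (g i + 1)) f v *
      ((subtreeSize ℓ f n v : ℝ) * (subtreeSize ℓ f n v + 1) * (subtreeSize ℓ f n v + 2) + 12))
    (fun v _ => mul_nonneg (vertexWeight_nonneg (fun i => by positivity) v) (by positivity))
    (Finset.mem_range.2 hv)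
  rw [branchPotential]
  set X := ∑ v ∈ Finset.range n, vertexWeight ℓ pos (fun i => (1 / 2) ^ (g i + 1)) f v *
    ((subtreeSize ℓ f n v : ℝ) * (subtreeSize ℓ f n v + 1) * (subtreeSize ℓ f n v + 2) + 12)
    with hX
  have hs0 : (0 : ℝ) ≤ subtreeSize ℓ f n v := Nat.cast_nonneg _
  change _ ≤ X at hsingle
  generalize (subtreeSize ℓ f n v : ℝ) = s at hs0 hsingle hmul
  have h1 : s * (s + 1) * (s + 2) ≤ X := by
    refine le_trans ?_ hsingle
    have : 0 ≤ s * (s + 1) * (s + 2) := by positivity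
    nlinarith
  have h2 : (3 * n) * (3 * (n + 1)) * (3 * (n + 2)) ≤ (s * ℓ) * ((s + 1) * ℓ) * ((s + 2) * ℓ) := by
    have h3 : 3 * ((n : ℝ) + 1) ≤ (s + 1) * ℓ := by linarith
    have h4 : 3 * ((n : ℝ) + 2) ≤ (s + 2) * ℓ := by linarith
    exact mul_le_mul (mul_le_mul hmul h3 (by positivity) (by positivity)) h4 (by positivity)
      (by positivity)
  rw [div_pow, div_mul_div_comm, one_le_div (by positivity)]
  calc (3 : ℝ) ^ 3 * (n * (n + 1) * (n + 2)) = (3 * n) * (3 * (n + 1)) * (3 * (n + 2)) := by ring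
    _ ≤ (s * ℓ) * ((s + 1) * ℓ) * ((s + 2) * ℓ) := h2
    _ = (ℓ : ℝ) ^ 3 * (s * (s + 1) * (s + 2)) := by ring
    _ ≤ (ℓ : ℝ) ^ 3 * X := by gcongr

/-- The first `r + c + 1` terms equal `(1 / 2) ^ (r + 1)`; the geometric tail adds at most one more
such term. -/
theorem sum_half_pow_max_le (r c N : ℕ) :
    ∑ i ∈ Finset.range N, (1 / 2 : ℝ) ^ (max r (i - c) + 1) ≤ (1 / 2) ^ (r + 1) * (r + c + 2) := by
  have hgeom : ∀ N, ∑ t ∈ Finset.range N, (1 / 2 : ℝ) ^ (t + 1) = 1 - (1 / 2) ^ N := by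
    intro N
    induction N with
    | zero => simp
    | succ N ih =>
      rw [Finset.sum_range_succ, ih]
      ring
  calc ∑ i ∈ Finset.range N, (1 / 2 : ℝ) ^ (max r (i - c) + 1)
      ≤ ∑ i ∈ Finset.range (r + c + 1 + N), (1 / 2 : ℝ) ^ (max r (i - c) + 1) :=
        Finset.sum_le_sum_of_subset_of_nonneg (Finset.range_subset_range.2 (by omega))
          fun _ _ _ => by positivity
    _ = ∑ i ∈ Finset.range (r + c + 1), (1 / 2 : ℝ) ^ (r + 1) +
          ∑ t ∈ Finset.range N, (1 / 2 : ℝ) ^ (r + 1) * (1 / 2) ^ (t + 1) := by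
        rw [Finset.sum_range_add]
        congr 1
        · refine Finset.sum_congr rfl fun i hi => ?_
          have := Finset.mem_range.1 hi
          rw [max_eq_left (by omega)]
        · refine Finset.sum_congr rfl fun t _ => ?_
          rw [← pow_add]
          congr 1
          omega
    _ ≤ _ := by
        rw [← Finset.mul_sum, hgeom, Finset.sum_const, Finset.card_range, nsmul_eq_mul]
        have h1 : (0 : ℝ) ≤ (1 / 2) ^ N := by positivity
        have h2 : (0 : ℝ) ≤ (1 / 2) ^ (r + 1) := by positivity
        push_cast
        nlinarith

theorem sum_half_pow_max_min_le (ℓ r c : ℕ) :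
    ∑ i ∈ Finset.range ℓ, (1 / 2 : ℝ) ^ (max r (min i (ℓ - 1 - i) - c) + 1) ≤
      (1 / 2) ^ r * (r + c + 2) := by
  have h := sum_half_pow_max_le r c ℓ
  calc ∑ i ∈ Finset.range ℓ, (1 / 2 : ℝ) ^ (max r (min i (ℓ - 1 - i) - c) + 1)
      ≤ ∑ i ∈ Finset.range ℓ, ((1 / 2 : ℝ) ^ (max r (i - c) + 1) +
          (1 / 2 : ℝ) ^ (max r (ℓ - 1 - i - c) + 1)) := by
        refine Finset.sum_le_sum fun i _ => ?_
        rcases min_choice i (ℓ - 1 - i) with h | h <;> rw [h]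
        · exact le_add_of_nonneg_right (by positivity)
        · exact le_add_of_nonneg_left (by positivity)
    _ = 2 * ∑ i ∈ Finset.range ℓ, (1 / 2 : ℝ) ^ (max r (i - c) + 1) := by
        rw [Finset.sum_add_distrib,
          Finset.sum_range_reflect (fun i => (1 / 2 : ℝ) ^ (max r (i - c) + 1)) ℓ]
        ring
    _ ≤ _ := by
        rw [pow_succ] at h
        linarith

theorem three_pow_div_factorial_le {a : ℕ} (ha : 12 ≤ a) :
    2 * (3 ^ a / a.factorial : ℝ) ≤ 1 / 5 * (6 / 7) ^ (2 * a + 2) := by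
  induction a, ha using Nat.le_induction with
  | base =>
    norm_num [Nat.factorial]
  | succ a ha ih =>
    have ha' : (12 : ℝ) ≤ a := by exact_mod_cast ha
    have h1 : (3 : ℝ) / (a + 1) ≤ (6 / 7) ^ 2 := by
      rw [div_le_iff₀ (by positivity)]
      nlinarith
    have h2 : (3 ^ (a + 1) / (a + 1).factorial : ℝ) = 3 / (a + 1) * (3 ^ a / a.factorial) := by
      rw [Nat.factorial_succ, pow_succ]
      push_cast
      field_simp
    calc 2 * (3 ^ (a + 1) / (a + 1).factorial : ℝ)
        = 3 / (a + 1) * (2 * (3 ^ a / a.factorial)) := by rw [h2]; ring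
      _ ≤ (6 / 7) ^ 2 * (1 / 5 * (6 / 7) ^ (2 * a + 2)) := by gcongr
      _ = _ := by ring

theorem linear_mul_half_pow_le {a : ℕ} (ha : 12 ≤ a) :
    4 / 9 * ((4 * a + 5) * (1 / 2 : ℝ) ^ a) ≤ 4 / 5 * (6 / 7) ^ (2 * a + 2) := by
  induction a, ha using Nat.le_induction with
  | base => norm_num
  | succ a ha ih =>
    have ha' : (12 : ℝ) ≤ a := by exact_mod_cast ha
    have h1 : (4 * (a + 1) + 5 : ℝ) * (1 / 2) ≤ (6 / 7) ^ 2 * (4 * a + 5) := by linarith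
    push_cast
    calc 4 / 9 * ((4 * (a + 1) + 5) * (1 / 2 : ℝ) ^ (a + 1))
        = 4 / 9 * ((4 * (a + 1) + 5) * (1 / 2) * (1 / 2 : ℝ) ^ a) := by ring
      _ ≤ 4 / 9 * ((6 / 7) ^ 2 * (4 * a + 5) * (1 / 2 : ℝ) ^ a) := by gcongr
      _ = (6 / 7) ^ 2 * (4 / 9 * ((4 * a + 5) * (1 / 2 : ℝ) ^ a)) := by ring
      _ ≤ (6 / 7) ^ 2 * (4 / 5 * (6 / 7) ^ (2 * a + 2)) := by gcongr
      _ = _ := by ring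

/-- The block terms take at most `1 / 5` of `(6 / 7) ^ (2 * a + 2)` and the branch term at most `4 /
5`. -/
theorem failure_bound_le {a r : ℕ} (ha : 12 ≤ a) (har : a ≤ r) (hra : r ≤ a + 1) :
    2 * (3 ^ a / a.factorial : ℝ) + 4 / 9 * ((1 / 2) ^ r * (2 * a + 2 * r + 3)) ≤
      (6 / 7) ^ (a + r + 1) := by
  have h1 := three_pow_div_factorial_le ha
  have h2 := linear_mul_half_pow_le ha
  have h3 : (1 / 2 : ℝ) ^ r * (2 * a + 2 * r + 3) ≤ (4 * a + 5) * (1 / 2 : ℝ) ^ a := by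
    have hr : (r : ℝ) ≤ a + 1 := by exact_mod_cast hra
    rw [mul_comm]
    gcongr ?_ * ?_
    · linarith
    · exact pow_le_pow_of_le_one (by norm_num) (by norm_num) har
  have h4 : (6 / 7 : ℝ) ^ (2 * a + 2) ≤ (6 / 7) ^ (a + r + 1) :=
    pow_le_pow_of_le_one (by norm_num) (by norm_num) (by omega)
  linarith

end Bounds

/-! ### Assembly of the probability bound and choice of parameters. -/

/-- The middle vertices of a long path with sufficiently heavy ends are seed vertices of
the uniform attachment tree with high probability. -/
theorem le_prob_pathCoreSelector {ℓ : ℕ} [NeZero ℓ] {S : SimpleGraph (Fin ℓ)}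
    (e : S ≃g SimpleGraph.pathGraph ℓ) {a r : ℕ} (ha : 0 < a) (hr : 0 < r)
    (h : 2 * a + 2 * r + 1 ≤ ℓ) (d : ℕ) (hk : ℓ - 2 * a - 2 * r ≤ ℓ + d) :
    ENNReal.ofReal (1 - (2 * (3 ^ a / a.factorial : ℝ) +
        4 / 9 * ((1 / 2) ^ r * (2 * a + 2 * r + 3)))) ≤
      (uniformAttachment S d).toOuterMeasure
        {T | (pathCoreSelector (ℓ + d) (3 * (ℓ + d) / ℓ + 1) (ℓ - 2 * a) r hk).FindsOnly
          (seedVertices ℓ d) T} := by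
  classical
  set n := ℓ + d with hn
  set c := 2 * a + r + 1 with hc
  set pos : ℕ → ℕ := fun i => if hi : i < ℓ then (e ⟨i, hi⟩ : ℕ) else 0 with hposdef
  have hval : ∀ u : Fin ℓ, pos u = e u := fun u => dif_pos u.2
  have hpos : ∀ i < ℓ, pos i < ℓ := fun i hi => by
    rw [hval ⟨i, hi⟩]
    exact (e ⟨i, hi⟩).2
  have hinj : ∀ i < ℓ, ∀ j < ℓ, pos i = pos j → i = j := by
    intro i hi j hj hij
    rw [hval ⟨i, hi⟩, hval ⟨j, hj⟩] at hij
    exact congrArg Fin.val (e.injective (Fin.ext hij))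
  have hsurj : ∀ i < ℓ, ∃ j < ℓ, pos j = i := by
    intro i hi
    refine ⟨e.symm ⟨i, hi⟩, (e.symm ⟨i, hi⟩).2, ?_⟩
    rw [hval, RelIso.apply_symm_apply]
  have hS : ∀ u v : Fin ℓ, S.Adj u v ↔ (pos u + 1 = pos v ∨ pos v + 1 = pos u) := by
    intro u v
    rw [← e.map_adj_iff, SimpleGraph.pathGraph_adj, hval, hval]
  have hleft : ((Finset.range ℓ).filter fun v => pos v ≤ a).card = a + 1 := by
    rw [card_filter_pos hinj hsurj hpos (fun i => i ≤ a)]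
    rw [← Finset.card_range (a + 1)]
    congr 1
    ext i
    simp only [Finset.mem_filter, Finset.mem_range]
    omega
  have hright : ((Finset.range ℓ).filter fun v => ℓ ≤ pos v + a + 1).card = a + 1 := by
    rw [card_filter_pos hinj hsurj hpos (fun i => ℓ ≤ i + a + 1)]
    have : ((Finset.range ℓ).filter fun i => ℓ ≤ i + a + 1) = Finset.Ico (ℓ - (a + 1)) ℓ := by
      ext i
      simp only [Finset.mem_filter, Finset.mem_range, Finset.mem_Ico]
      omega
    rw [this, Nat.card_Ico]
    omega
  set g : ℕ → ℕ := fun i => max r (min i (ℓ - 1 - i) - c) with hg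
  set y : ℕ → ℝ := fun i => (1 / 2) ^ (g i + 1) with hy
  have hy0 : ∀ i, 0 ≤ y i := fun i => by positivity
  set Φ : ℕ → (ℕ → ℕ) → ℝ := fun n f =>
    (3 / ℓ : ℝ) ^ a * blockPotential ℓ pos (fun i => i ≤ a) a n f +
      (3 / ℓ : ℝ) ^ a * blockPotential ℓ pos (fun i => ℓ ≤ i + a + 1) a n f +
      (ℓ / 3 : ℝ) ^ 3 * branchPotential ℓ pos y n f with hΦdef
  have hΦ : ∀ n, ℓ ≤ n → ∀ f, IsParentMap ℓ f →
      ∑ p ∈ Finset.range n, Φ (n + 1) (Function.update f n p) ≤ n * Φ n f := by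
    intro n hn f _
    simp only [hΦdef]
    rw [Finset.sum_add_distrib, Finset.sum_add_distrib, ← Finset.mul_sum, ← Finset.mul_sum,
      ← Finset.mul_sum, sum_blockPotential (by rw [hleft]; omega) hn,
      sum_blockPotential (by rw [hright]; omega) hn, sum_branchPotential hn (by omega)]
    apply le_of_eq
    ring
  have hf₀ : IsParentMap ℓ fun _ => 0 := fun v hv => (show 0 < ℓ by omega).trans_le hv
  have hinit : Φ ℓ (fun _ => 0) ≤ 2 * (3 ^ a / a.factorial : ℝ) +
      4 / 9 * ((1 / 2) ^ r * (2 * a + 2 * r + 3)) := by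
    have h1 := blockPotential_seed_le (P := fun i => i ≤ a) (f := fun _ => 0) (by omega) hleft
    have h2 := blockPotential_seed_le (P := fun i => ℓ ≤ i + a + 1) (f := fun _ => 0) (by omega) hright
    have h3 := branchPotential_seed_le (f := fun _ => 0) hy0 (by omega) hinj hsurj hpos
    have h4 := sum_half_pow_max_min_le ℓ r c
    have h5 : (r + c + 2 : ℝ) = 2 * a + 2 * r + 3 := by
      rw [hc]
      push_cast
      ring
    rw [h5] at h4
    have h6 : 4 / 9 * ∑ i ∈ Finset.range ℓ, y i ≤
        4 / 9 * ((1 / 2) ^ r * (2 * a + 2 * r + 3)) := by gcongr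
    simp only [hΦdef]
    linarith
  set A := {T | (pathCoreSelector n (3 * n / ℓ + 1) (ℓ - 2 * a) r hk).FindsOnly
    (seedVertices ℓ d) T} with hA
  have hgood : ∀ (f : ℕ → ℕ) (T : SimpleGraph (Fin (ℓ + d))), IsParentMap ℓ f →
      (∀ u v : Fin (ℓ + d), T.Adj u v ↔ GrownAdj ℓ pos f u v) →
      ENNReal.ofReal (1 - Φ (ℓ + d) f) ≤ if T ∈ A then 1 else 0 := by
    intro f T hf hT
    have n1 : 0 ≤ (3 / ℓ : ℝ) ^ a * blockPotential ℓ pos (fun i => i ≤ a) a n f :=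
      mul_nonneg (by positivity) blockPotential_nonneg
    have n2 : 0 ≤ (3 / ℓ : ℝ) ^ a * blockPotential ℓ pos (fun i => ℓ ≤ i + a + 1) a n f :=
      mul_nonneg (by positivity) blockPotential_nonneg
    have n3 : 0 ≤ (ℓ / 3 : ℝ) ^ 3 * branchPotential ℓ pos y n f :=
      mul_nonneg (by positivity) (branchPotential_nonneg hy0)
    split_ifs with hTA
    · rw [← ENNReal.ofReal_one]
      apply ENNReal.ofReal_le_ofReal
      simp only [hΦdef, ← hn]
      linarith
    -- On failure one must show `Φ ≥ 1`: if `Φ < 1`, each nonnegative summand is below `1`, so no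
    -- bad event occurs and the selector succeeds.
    · rw [nonpos_iff_eq_zero, ENNReal.ofReal_eq_zero, sub_nonpos]
      by_contra! hlt
      simp only [hΦdef, ← hn] at hlt
      refine hTA (pathCoreSelector_findsOnly hk ?_ fun H hH v hv => ?_)
      · refine exists_isPathCore hf hinj hsurj (by omega) hT (by omega) ?_ ?_
        · by_contra! hlt'
          have := one_le_blockPotential (pos := pos) (P := fun i => i ≤ a) (f := f) (n := n) (a := a) (by omega) (by omega)
            (by rw [hleft]; omega) hlt'
          linarith
        · by_contra! hlt'
          have := one_le_blockPotential (pos := pos) (P := fun i => ℓ ≤ i + a + 1)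
            (f := f) (n := n) (a := a) (by omega) (by omega)
            (by rw [hright]; omega) hlt'
          linarith
      · have hvℓ : (v : ℕ) < ℓ := by
          refine hH.lt_of_mem hf hinj hsurj hpos (by omega) hT (by omega) ?_ hv
          intro w hw _ hs
          by_contra! hlt'
          have := one_le_branchPotential (pos := pos) (f := f) (g := g) (by omega) hw hs hlt'
          linarith
        rw [seedVertices, Finset.mem_map]
        exact ⟨⟨v, hvℓ⟩, Finset.mem_univ _, rfl⟩
  have hmain := le_tsum_uniformAttachment hS hΦ hf₀ d (fun T => if T ∈ A then 1 else 0) hgood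
  rw [PMF.toOuterMeasure_apply]
  refine (ENNReal.ofReal_le_ofReal (sub_le_sub_left hinit 1)).trans (hmain.trans ?_)
  refine ENNReal.tsum_le_tsum fun T => ?_
  rw [Set.indicator_apply]
  split_ifs <;> simp

/-- Since `e ^ 2 ≥ 7`, one has `6 / 7 ≤ 1 - e ^ (-2) ≤ exp (-e ^ (-2))`, whose power `M + 1` is at
most `ε`. -/
theorem six_sevenths_pow_le {ε x : ℝ} (hε : 0 < ε)
    (hx : Real.exp 1 ^ 2 * Real.log (1 / ε) ≤ x) {M : ℕ} (hM : x ≤ M + 1) :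
    (6 / 7 : ℝ) ^ (M + 1) ≤ ε := by
  have he := Real.exp_one_gt_d9
  have he2 : (7 : ℝ) ≤ Real.exp 1 ^ 2 := by nlinarith
  have he0 : 0 < Real.exp 1 ^ 2 := by positivity
  have h1 : -((M + 1 : ℕ) * (1 / Real.exp 1 ^ 2)) ≤ Real.log ε := by
    rw [one_div ε, Real.log_inv] at hx
    have : -Real.log ε ≤ (M + 1) / Real.exp 1 ^ 2 := by
      rw [le_div_iff₀ he0]
      linarith
    push_cast
    rw [mul_one_div]
    linarith
  have h2 : (6 / 7 : ℝ) ≤ Real.exp (-(1 / Real.exp 1 ^ 2)) := by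
    have h3 := Real.add_one_le_exp (-(1 / Real.exp 1 ^ 2))
    have h4 : 1 / Real.exp 1 ^ 2 ≤ 1 / 7 := one_div_le_one_div_of_le (by norm_num) he2
    linarith
  calc (6 / 7 : ℝ) ^ (M + 1) ≤ Real.exp (-(1 / Real.exp 1 ^ 2)) ^ (M + 1) := by gcongr
    _ = Real.exp (-((M + 1 : ℕ) * (1 / Real.exp 1 ^ 2))) := by
      rw [← Real.exp_nat_mul, mul_neg]
    _ ≤ Real.exp (Real.log ε) := Real.exp_le_exp.2 h1
    _ = ε := Real.exp_log hε

theorem twenty_four_le_of_le {x : ℝ}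
    (hx : Real.exp 1 ^ 2 * Real.log (4 * Real.exp 1 ^ 2) ≤ x) : 24 ≤ x := by
  have he := Real.exp_one_gt_d9
  have he2 : (7.38 : ℝ) ≤ Real.exp 1 ^ 2 := by nlinarith
  have hlog : Real.log (4 * Real.exp 1 ^ 2) = 2 * Real.log 2 + 2 := by
    rw [Real.log_mul (by norm_num) (by positivity), show (4 : ℝ) = 2 ^ 2 by norm_num,
      Real.log_pow, Real.log_pow, Real.log_exp]
    norm_num
  have h2 := Real.log_two_gt_d9
  rw [hlog] at hx
  nlinarith

theorem theorem1 (ε γ : ℝ) (hε0 : 0 < ε) (hε1 : ε < 1) (hγ0 : 0 < γ) (hγ1 : γ < 1)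
    (ℓ : ℕ) [NeZero ℓ]
    (hℓ : max (2 * Real.exp 1 ^ 2 / γ * Real.log (1 / ε))
      (2 * Real.exp 1 ^ 2 / γ * Real.log (4 * Real.exp 1 ^ 2)) ≤ (ℓ : ℝ)) :
    ∃ k : ℕ, (1 - γ) * (ℓ : ℝ) ≤ (k : ℝ) ∧ k ≤ ℓ ∧
      ∃ N : ℕ, ∀ d : ℕ, N ≤ ℓ + d →
        ∃ A : VertexSelector (ℓ + d) k,
          ∀ S : SimpleGraph (Fin ℓ), Nonempty (S ≃g SimpleGraph.pathGraph ℓ) →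
            ENNReal.ofReal (1 - ε) ≤
              (uniformAttachment S d).toOuterMeasure
                {T | A.FindsOnly (seedVertices ℓ d) T} := by
  have hℓ0 : (0 : ℝ) < ℓ := by exact_mod_cast Nat.pos_of_ne_zero (NeZero.ne ℓ)
  have hscale : ∀ L : ℝ, 2 * Real.exp 1 ^ 2 / γ * L ≤ ℓ → Real.exp 1 ^ 2 * L ≤ γ * ℓ / 2 := by
    intro L hL
    rw [div_mul_eq_mul_div, div_le_iff₀ hγ0] at hL
    linarith
  have hx1 := hscale _ ((le_max_left _ _).trans hℓ)
  have hx2 := twenty_four_le_of_le (hscale _ ((le_max_right _ _).trans hℓ))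
  set M := ⌊γ * ℓ / 2⌋₊ with hM
  have hM24 : 24 ≤ M := Nat.le_floor (by exact_mod_cast hx2)
  have hMle : (M : ℝ) ≤ γ * ℓ / 2 := Nat.floor_le (by positivity)
  have hMlt : γ * ℓ / 2 < M + 1 := Nat.lt_floor_add_one _
  have h2M : 2 * M < ℓ := by
    have : (2 * M : ℝ) < ℓ := by nlinarith
    exact_mod_cast this
  obtain ⟨a, r, har, ha, h1, h2⟩ : ∃ a r, a + r = M ∧ 12 ≤ a ∧ a ≤ r ∧ r ≤ a + 1 :=
    ⟨M / 2, M - M / 2, by omega, by omega, by omega, by omega⟩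
  -- The threshold `0` suffices: the bound holds for every `n ≥ ℓ`.
  refine ⟨ℓ - 2 * a - 2 * r, ?_, by omega, 0, fun d _ => ?_⟩
  · have hk : ((ℓ - 2 * a - 2 * r : ℕ) : ℝ) = ℓ - 2 * M := by
      rw [show ℓ - 2 * a - 2 * r = ℓ - 2 * M by omega, Nat.cast_sub h2M.le]
      push_cast
      ring
    rw [hk]
    linarith
  · refine ⟨pathCoreSelector (ℓ + d) (3 * (ℓ + d) / ℓ + 1) (ℓ - 2 * a) r (by omega), ?_⟩
    rintro S ⟨e⟩
    refine le_trans (ENNReal.ofReal_le_ofReal ?_)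
      (le_prob_pathCoreSelector e (by omega) (by omega) (by omega) d _)
    have h3 := failure_bound_le ha h1 h2
    rw [har] at h3
    have h4 := six_sevenths_pow_le hε0 hx1 hMlt.le
    linarith
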